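/- A closed polygonal chain $C$ in $\mathbb R^3$ with $p$ vertices is given by a cyclic sequence of points $x_1,\dots,x_p\in\mathbb R^3$, with indices taken modulo $p$; its edges are the segments $x_ix_{i+1}$. The direction of a non-zero vector is its equivalence class under multiplication by positive real numbers; directions are identified with points of the unit sphere $S^2$. The direction set of $C$ is $$\mathrm{dir}(C)=\bigcup_{i=1}^{p}\Big(\{\text{direction of } x-x_i : x\in x_{i-1}x_{i+1},\ x\neq x_i\}\cup\{\text{direction of } x_i-x : x\in x_{i-1}x_{i+1},\ x\ne x_i\}\Big),$$ where $x_{i-1}x_{i+1}$ denotes the straight-line segment between these points. Call $C$ nondegenerate if $x_i\notin x_{i-1}x_{i+1}$ for every $i$, so that all the vectors above are non-zero. The Kakeya motion along $C$ is the following continuous motion of a needle $ab$ during the time interval $[0,2p]$. It starts with $a=x_1$ and $b=x_2$. For $k=0,1,\dots,2p-1$, during the time interval $[k,k+1]$ one end of the needle stays at $x_{k+2}$ while the other one moves at constant speed along the segment from $x_{k+1}$ to $x_{k+3}$; the moving end is $a$ if $k$ is even and $b$ if $k$ is odd. **Lemma.** Let $C_1$ and $C_2$ be two nondegenerate closed polygonal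 chains in $\mathbb R^3$, each with an odd number of vertices. Then $\mathrm{dir}(C_1)\cap\mathrm{dir}(C_2)\neq\emptyset$. Moreover, for each $C\in\{C_1,C_2\}$, the needle $ab$ of the Kakeya motion along $C$ never has length zero, the set of directions of $\overrightarrow{ab}$ that occur during the motion is exactly $\mathrm{dir}(C)$, and the unit vector $\overrightarrow{ab}/\|\overrightarrow{ab}\|$ traces a closed curve on $S^2$ (continuous, with equal start and end points) whose set of points is exactly $\mathrm{dir}(C)$, viewed as a subset of $S^2$, and is antipodal, i.e. closed under $u\mapsto -u$. -/

import Mathlib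

/-- A closed polygonal chain with `p` vertices in `E` is given by its cyclic sequence of vertices
`x : ZMod p → E`, the indices being taken modulo `p`. It is nondegenerate if no vertex lies on the
segment joining its two neighbours; equivalently, none of the vectors `z - x i` with `z` on the
segment from `x (i - 1)` to `x (i + 1)` is zero, so that each of them has a direction. -/
def ChainNondegenerate {E : Type*} [AddCommGroup E] [Module ℝ E] {p : ℕ} (x : ZMod p → E) : Prop :=
  ∀ i : ZMod p, x i ∉ segment ℝ (x (i - 1)) (x (i + 1))

/-- The directions of the vectors from `b` to the points `z` of the segment from `a` to `c`.
A direction is a class of nonzero vectors up to positive scaling, that is, a `Module.Ray`. -/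
def forkOut {E : Type*} [AddCommGroup E] [Module ℝ E] (a b c : E) : Set (Module.Ray ℝ E) :=
  {d | ∃ z ∈ segment ℝ a c, ∃ h : z - b ≠ 0, d = rayOfNeZero ℝ (z - b) h}

/-- The directions of the vectors from the points `z` of the segment from `a` to `c` to `b`. -/
def forkIn {E : Type*} [AddCommGroup E] [Module ℝ E] (a b c : E) : Set (Module.Ray ℝ E) :=
  {d | ∃ z ∈ segment ℝ a c, ∃ h : b - z ≠ 0, d = rayOfNeZero ℝ (b - z) h}

/-- The direction set of a closed polygonal chain. -/
def chainDirections {E : Type*} [AddCommGroup E] [Module ℝ E] {p : ℕ} (x : ZMod p → E) :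
    Set (Module.Ray ℝ E) :=
  ⋃ i : ZMod p, forkOut (x (i - 1)) (x i) (x (i + 1)) ∪ forkIn (x (i - 1)) (x i) (x (i + 1))

/-- The motion, during the time interval `[0, 2p]`, of a needle with ends `a` and `b` along the
closed polygonal chain `x`, walking around the chain twice: it starts with `a` at `x 1` and `b` at
`x 2`, and during each unit of time one end rests at a vertex while the other one moves along a
segment from the preceding vertex to the following vertex, the two ends taking turns. -/
def IsKakeyaMotion {E : Type*} [NormedAddCommGroup E] [NormedSpace ℝ E] {p : ℕ}
    (x : ZMod p → E) (a b : ℝ → E) : Prop :=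
  ContinuousOn a (Set.Icc 0 (2 * p)) ∧ ContinuousOn b (Set.Icc 0 (2 * p)) ∧
  ∀ k : ℕ, k < 2 * p → ∀ s ∈ Set.Icc (0 : ℝ) 1,
    (Even k → a (k + s) = AffineMap.lineMap (x (k + 1)) (x (k + 3)) s ∧ b (k + s) = x (k + 2)) ∧
    (Odd k → a (k + s) = x (k + 2) ∧ b (k + s) = AffineMap.lineMap (x (k + 1)) (x (k + 3)) s)

/-- The points of the unit sphere that represent the directions in `D`. -/
def spherePoints {E : Type*} [NormedAddCommGroup E] [NormedSpace ℝ E]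
    (D : Set (Module.Ray ℝ E)) : Set E :=
  {u | ‖u‖ = 1 ∧ ∃ h : u ≠ 0, rayOfNeZero ℝ u h ∈ D}

/-- `γ`, on the time interval `[0, T]`, is a closed curve on the unit sphere whose trace is closed
under taking antipodal points. -/
def IsClosedAntipodalCurve {E : Type*} [NormedAddCommGroup E] [NormedSpace ℝ E]
    (T : ℝ) (γ : ℝ → E) : Prop :=
  ContinuousOn γ (Set.Icc 0 T) ∧ (∀ t ∈ Set.Icc 0 T, ‖γ t‖ = 1) ∧ γ 0 = γ T ∧
  ∀ u ∈ γ '' Set.Icc 0 T, -u ∈ γ '' Set.Icc 0 T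

/-- A needle performing the Kakeya motion along the chain `x` never has length zero, sweeps exactly
the directions of the chain, and its unit direction vector runs through a closed antipodal curve
whose trace on the unit sphere consists of exactly the directions of the chain. -/
def SweptByKakeyaMotion {E : Type*} [NormedAddCommGroup E] [NormedSpace ℝ E] {p : ℕ}
    (x : ZMod p → E) : Prop :=
  ∃ a b : ℝ → E, IsKakeyaMotion x a b ∧
    (∀ t ∈ Set.Icc (0 : ℝ) (2 * p), b t - a t ≠ 0) ∧
    chainDirections x =
      {d | ∃ t ∈ Set.Icc (0 : ℝ) (2 * p), ∃ h : b t - a t ≠ 0, d = rayOfNeZero ℝ (b t - a t) h} ∧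
    IsClosedAntipodalCurve (2 * p) (fun t => ‖b t - a t‖⁻¹ • (b t - a t)) ∧
    (fun t => ‖b t - a t‖⁻¹ • (b t - a t)) '' Set.Icc (0 : ℝ) (2 * p) =
      spherePoints (chainDirections x)

/-! During each unit of time the needle vector runs along a segment joining two consecutive signed
edges `needleVertex x k`. As `p` is odd, one tour of the chain reverses the sign
(`needleVertex_add_period`), so the first `p` of these segments form a polygon from a vector to its
negative, which is a one-sided closed curve in the projective plane. Nondegeneracy keeps the
segments away from the origin. The second tour supplies the opposite directions, which gives
`sweptByKakeyaMotion`.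

Two one-sided curves in the projective plane meet. For generic polygons `f`, `g`, crossings are
counted modulo 2 by signs of determinants. By `crossing_triangle` the boundary of a triangle meets
the closed polygon `g` evenly, so `f` can be coned off from `f 0` until only the arcs from `f (p -
1)` to `f 0` and to `-f 0` remain. Together they make up a projective line, which `g` crosses an odd
number of times since its ends are antipodal (`sum_crossing_eq_one`). Arbitrary polygons are limits
of generic ones, and compactness preserves a common point (`exists_cone_inter`). Directions are
recovered from projective points because direction sets are closed under negation. -/

open Filter Topology

/-! ### Signs of determinants and crossing parity in the projective plane -/

/-- The determinant of three vectors of `ℝ³`. -/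
def tripleDet (a b c : Fin 3 → ℝ) : ℝ :=
  a 0 * (b 1 * c 2 - b 2 * c 1) - a 1 * (b 0 * c 2 - b 2 * c 0) + a 2 * (b 0 * c 1 - b 1 * c 0)

/-- The sign of a nonzero real number as an element of `ZMod 2`. -/
noncomputable def signBit (r : ℝ) : ZMod 2 := if r < 0 then 1 else 0

/-- For generic vectors, the number modulo 2 of common points of the arcs from `a` to `b` and from
`c` to `d` in the projective plane. -/
noncomputable def crossing (a b c d : Fin 3 → ℝ) : ZMod 2 :=
  (signBit (tripleDet a b c) + signBit (tripleDet a b d)) *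
    (signBit (tripleDet c d a) + signBit (tripleDet c d b))

/-- For generic vectors, whether `c` represents a point of the projective triangle `a b e`. -/
noncomputable def insideTriangle (a b e c : Fin 3 → ℝ) : ZMod 2 :=
  (1 + signBit (tripleDet b e c) + signBit (tripleDet e a c)) *
    (1 + signBit (tripleDet e a c) + signBit (tripleDet a b c))

lemma signBit_of_neg {r : ℝ} (h : r < 0) : signBit r = 1 := if_pos h

lemma signBit_of_pos {r : ℝ} (h : 0 < r) : signBit r = 0 := if_neg h.not_gt

lemma signBit_neg {r : ℝ} (h : r ≠ 0) : signBit (-r) = signBit r + 1 := by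
  rcases h.lt_or_gt with h | h
  · rw [signBit_of_neg h, signBit_of_pos (by linarith)]; decide
  · rw [signBit_of_pos h, signBit_of_neg (by linarith)]; decide

lemma signBit_mul {r s : ℝ} (hr : r ≠ 0) (hs : s ≠ 0) :
    signBit (r * s) = signBit r + signBit s := by
  rcases hr.lt_or_gt with h | h <;> rcases hs.lt_or_gt with h' | h'
  · rw [signBit_of_neg h, signBit_of_neg h', signBit_of_pos (mul_pos_of_neg_of_neg h h')]; decide
  · rw [signBit_of_neg h, signBit_of_pos h', signBit_of_neg (mul_neg_of_neg_of_pos h h')]; decide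
  · rw [signBit_of_pos h, signBit_of_neg h', signBit_of_neg (mul_neg_of_pos_of_neg h h')]; decide
  · rw [signBit_of_pos h, signBit_of_pos h', signBit_of_pos (mul_pos h h')]; decide

lemma signBit_eq_of_add_eq {r s t : ℝ} (hr : r ≠ 0) (hs : s ≠ 0) (ht : t = r + s)
    (h : signBit r = signBit s) : signBit t = signBit r := by
  rcases hr.lt_or_gt with h1 | h1 <;> rcases hs.lt_or_gt with h2 | h2
  · rw [signBit_of_neg h1, signBit_of_neg (by linarith)]
  · rw [signBit_of_neg h1, signBit_of_pos h2] at h; exact absurd h (by decide)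
  · rw [signBit_of_pos h1, signBit_of_neg h2] at h; exact absurd h (by decide)
  · rw [signBit_of_pos h1, signBit_of_pos (by linarith)]

lemma signBit_sub_eq {a b c d m : ℝ} (ha : a ≠ 0) (hb : b ≠ 0) (hc : c ≠ 0) (hd : d ≠ 0)
    (hm : m = a * b - c * d) (h : signBit a + signBit b = signBit c + signBit d + 1) :
    signBit m = signBit a + signBit b := by
  rw [← signBit_mul ha hb] at h ⊢
  rw [← signBit_mul hc hd, ← signBit_neg (mul_ne_zero hc hd)] at h
  exact signBit_eq_of_add_eq (mul_ne_zero ha hb) (neg_ne_zero.2 (mul_ne_zero hc hd))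
    (by linarith) h

lemma signBit_not_all_eq {a b c x y z : ℝ} (ha : a ≠ 0) (hb : b ≠ 0) (hc : c ≠ 0)
    (hx : x ≠ 0) (hy : y ≠ 0) (hz : z ≠ 0) (h : a * x + b * y + c * z = 0) :
    ¬ (signBit a + signBit x = signBit b + signBit y ∧
      signBit b + signBit y = signBit c + signBit z) := by
  rw [← signBit_mul ha hx, ← signBit_mul hb hy, ← signBit_mul hc hz]
  rintro ⟨h1, h2⟩
  have h3 := signBit_eq_of_add_eq (mul_ne_zero ha hx) (mul_ne_zero hb hy) (t := -(c * z))
    (by linarith) h1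
  rw [signBit_neg (mul_ne_zero hc hz), h1, h2] at h3
  revert h3
  generalize signBit (c * z) = w
  revert w
  decide

/-- The `cᵢ` and `dᵢ` stand for the signs of the coordinates of two vectors, the `mᵢ` for the signs
of their cross product. A minor has a forced sign when its two products have opposite signs;
orthogonality to either vector forbids three terms of equal sign. These constraints already suffice,
so a finite check remains. -/
lemma sign_pattern_parity : ∀ c₁ c₂ c₃ d₁ d₂ d₃ m₁ m₂ m₃ : ZMod 2,
    (c₂ + d₃ = c₃ + d₂ + 1 → m₁ = c₂ + d₃) →
    (c₃ + d₁ = c₁ + d₃ + 1 → m₂ = c₃ + d₁) →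
    (c₁ + d₂ = c₂ + d₁ + 1 → m₃ = c₁ + d₂) →
    ¬ (c₁ + m₁ = c₂ + m₂ ∧ c₂ + m₂ = c₃ + m₃) →
    ¬ (d₁ + m₁ = d₂ + m₂ ∧ d₂ + m₂ = d₃ + m₃) →
    (c₃ + d₃) * (m₁ + m₂) + (c₁ + d₁) * (m₂ + m₃) + (c₂ + d₂) * (m₃ + m₁) =
      (1 + c₁ + c₂) * (1 + c₂ + c₃) + (1 + d₁ + d₂) * (1 + d₂ + d₃) := by
  decide

/-- An arc crosses the boundary of a triangle an odd number of times if and only if exactly one of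
its ends lies in the triangle. -/
lemma crossing_triangle {a b e c d : Fin 3 → ℝ} (hD : tripleDet a b e ≠ 0)
    (hc₁ : tripleDet b e c ≠ 0) (hc₂ : tripleDet e a c ≠ 0) (hc₃ : tripleDet a b c ≠ 0)
    (hd₁ : tripleDet b e d ≠ 0) (hd₂ : tripleDet e a d ≠ 0) (hd₃ : tripleDet a b d ≠ 0)
    (ha : tripleDet c d a ≠ 0) (hb : tripleDet c d b ≠ 0) (he : tripleDet c d e ≠ 0) :
    crossing a b c d + crossing b e c d + crossing e a c d =
      insideTriangle a b e c + insideTriangle a b e d := by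
  -- In the basis `a`, `b`, `e` the coordinates of `c` and `d` are, up to the factor `tripleDet a b
  -- e`, the determinants on the right; the minors are those of their cross product.
  have h1 : tripleDet a b e * tripleDet c d a =
      tripleDet e a c * tripleDet a b d - tripleDet a b c * tripleDet e a d := by
    simp only [tripleDet]; ring
  have h2 : tripleDet a b e * tripleDet c d b =
      tripleDet a b c * tripleDet b e d - tripleDet b e c * tripleDet a b d := by
    simp only [tripleDet]; ring
  have h3 : tripleDet a b e * tripleDet c d e =
      tripleDet b e c * tripleDet e a d - tripleDet e a c * tripleDet b e d := by
    simp only [tripleDet]; ring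
  have key := sign_pattern_parity (signBit (tripleDet b e c)) (signBit (tripleDet e a c))
    (signBit (tripleDet a b c)) (signBit (tripleDet b e d)) (signBit (tripleDet e a d))
    (signBit (tripleDet a b d)) (signBit (tripleDet a b e * tripleDet c d a))
    (signBit (tripleDet a b e * tripleDet c d b)) (signBit (tripleDet a b e * tripleDet c d e))
    (signBit_sub_eq hc₂ hd₃ hc₃ hd₂ h1) (signBit_sub_eq hc₃ hd₁ hc₁ hd₃ h2)
    (signBit_sub_eq hc₁ hd₂ hc₂ hd₁ h3)
    (signBit_not_all_eq hc₁ hc₂ hc₃ (mul_ne_zero hD ha) (mul_ne_zero hD hb) (mul_ne_zero hD he)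
      (by rw [h1, h2, h3]; ring))
    (signBit_not_all_eq hd₁ hd₂ hd₃ (mul_ne_zero hD ha) (mul_ne_zero hD hb) (mul_ne_zero hD he)
      (by rw [h1, h2, h3]; ring))
  rw [signBit_mul hD ha, signBit_mul hD hb, signBit_mul hD he] at key
  simp only [crossing, insideTriangle]
  rw [← key]
  -- The sign of the basis enters every `mᵢ`, and the `mᵢ` occur in pairs, so it cancels modulo 2.
  have h0 : signBit (tripleDet a b e) + signBit (tripleDet a b e) = 0 := CharTwo.add_self_eq_zero _
  linear_combination (-(signBit (tripleDet a b c) + signBit (tripleDet a b d)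
    + signBit (tripleDet b e c) + signBit (tripleDet b e d)
    + signBit (tripleDet e a c) + signBit (tripleDet e a d))) * h0

lemma tripleDet_swap_left (a b c : Fin 3 → ℝ) : tripleDet b a c = -tripleDet a b c := by
  simp only [tripleDet]; ring

lemma tripleDet_rotate (a b c : Fin 3 → ℝ) : tripleDet b c a = tripleDet a b c := by
  simp only [tripleDet]; ring

lemma tripleDet_neg_mid (a b c : Fin 3 → ℝ) : tripleDet a (-b) c = -tripleDet a b c := by
  simp only [tripleDet, Pi.neg_apply]; ring

lemma tripleDet_neg_right (a b c : Fin 3 → ℝ) : tripleDet a b (-c) = -tripleDet a b c := by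
  simp only [tripleDet, Pi.neg_apply]; ring

lemma crossing_comm {a b c d : Fin 3 → ℝ} (hc : tripleDet a b c ≠ 0) (hd : tripleDet a b d ≠ 0) :
    crossing b a c d = crossing a b c d := by
  simp only [crossing]
  rw [tripleDet_swap_left a b c, tripleDet_swap_left a b d, signBit_neg hc, signBit_neg hd]
  generalize signBit (tripleDet a b c) = r
  generalize signBit (tripleDet a b d) = s
  generalize signBit (tripleDet c d a) = t
  generalize signBit (tripleDet c d b) = u
  revert r s t u
  decide

/-- The arcs from `a` to `b` and to `-b` together form a projective line; the arc from `c` to `d`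
crosses it exactly when the plane of `a`, `b` separates the vectors `c` and `d`. -/
lemma crossing_neg_mid {a b c d : Fin 3 → ℝ} (hc : tripleDet a b c ≠ 0) (hd : tripleDet a b d ≠ 0)
    (hb : tripleDet c d b ≠ 0) :
    crossing a (-b) c d =
      crossing a b c d + (signBit (tripleDet a b c) + signBit (tripleDet a b d)) := by
  simp only [crossing]
  rw [tripleDet_neg_mid a b c, tripleDet_neg_mid a b d, tripleDet_neg_right c d b,
    signBit_neg hc, signBit_neg hd, signBit_neg hb]
  generalize signBit (tripleDet a b c) = r
  generalize signBit (tripleDet a b d) = s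
  generalize signBit (tripleDet c d a) = t
  generalize signBit (tripleDet c d b) = u
  revert r s t u
  decide

lemma insideTriangle_neg {a b e c : Fin 3 → ℝ} (h₁ : tripleDet b e c ≠ 0)
    (h₂ : tripleDet e a c ≠ 0) (h₃ : tripleDet a b c ≠ 0) :
    insideTriangle a b e (-c) = insideTriangle a b e c := by
  simp only [insideTriangle]
  rw [tripleDet_neg_right, tripleDet_neg_right, tripleDet_neg_right,
    signBit_neg h₁, signBit_neg h₂, signBit_neg h₃]
  generalize signBit (tripleDet b e c) = r
  generalize signBit (tripleDet e a c) = s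
  generalize signBit (tripleDet a b c) = t
  revert r s t
  decide

lemma sum_add_succ_zmod_two (u : ℕ → ZMod 2) (n : ℕ) :
    ∑ l ∈ Finset.range n, (u l + u (l + 1)) = u 0 + u n := by
  have h := Finset.sum_range_sub u n
  rw [CharTwo.sub_eq_add] at h
  rw [add_comm, ← h]
  refine Finset.sum_congr rfl fun l _ => ?_
  rw [CharTwo.sub_eq_add, add_comm]

/-- Two generic antipodal polygons have an odd number of crossings in the projective plane. -/
theorem sum_crossing_eq_one {p q : ℕ} (hp : 2 ≤ p) (hq : 2 ≤ q) (f g : ℕ → Fin 3 → ℝ)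
    (hf : f p = -f 0) (hg : g q = -g 0)
    (hfff : ∀ i j k, i < j → j < k → k < p → tripleDet (f i) (f j) (f k) ≠ 0)
    (hffg : ∀ i j l, i < j → j < p → l < q → tripleDet (f i) (f j) (g l) ≠ 0)
    (hggf : ∀ l m i, l < m → m < q → i < p → tripleDet (g l) (g m) (f i) ≠ 0) :
    ∑ k ∈ Finset.range p, ∑ l ∈ Finset.range q,
      crossing (f k) (f (k + 1)) (g l) (g (l + 1)) = 1 := by
  have hffg' : ∀ i j l, i < j → j < p → l ≤ q → tripleDet (f i) (f j) (g l) ≠ 0 := by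
    intro i j l hij hj hl
    rcases hl.lt_or_eq with hl | rfl
    · exact hffg i j l hij hj hl
    · rw [hg, tripleDet_neg_right]
      exact neg_ne_zero.2 (hffg i j 0 hij hj (by omega))
  have hggf' : ∀ l i, l < q → i < p → tripleDet (g l) (g (l + 1)) (f i) ≠ 0 := by
    intro l i hl hi
    rcases (show l + 1 ≤ q from hl).lt_or_eq with h | h
    · exact hggf l (l + 1) i (by omega) h hi
    · rw [h, hg, tripleDet_neg_mid, tripleDet_swap_left, neg_neg]
      exact hggf 0 l i (by omega) hl hi
  set I : (Fin 3 → ℝ) → (Fin 3 → ℝ) → ZMod 2 := fun a b =>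
    ∑ l ∈ Finset.range q, crossing a b (g l) (g (l + 1)) with hI
  have hcomm : ∀ i j, i < j → j < p → I (f j) (f i) = I (f i) (f j) := by
    intro i j hij hj
    refine Finset.sum_congr rfl fun l hl => ?_
    have hl := Finset.mem_range.1 hl
    exact crossing_comm (hffg' i j l hij hj hl.le) (hffg' i j (l + 1) hij hj hl)
  have htri : ∀ k, 0 < k → k + 1 < p →
      I (f 0) (f k) + I (f k) (f (k + 1)) = I (f 0) (f (k + 1)) := by
    intro k hk hkp
    have hrev : ∀ l ≤ q, tripleDet (f (k + 1)) (f 0) (g l) ≠ 0 := by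
      intro l hl
      rw [tripleDet_swap_left]
      exact neg_ne_zero.2 (hffg' 0 (k + 1) l (by omega) hkp hl)
    have hsum : I (f 0) (f k) + I (f k) (f (k + 1)) + I (f (k + 1)) (f 0) = 0 := by
      simp only [hI, ← Finset.sum_add_distrib]
      rw [Finset.sum_congr rfl fun l hl => crossing_triangle
        (hfff 0 k (k + 1) hk (by omega) hkp)
        (hffg' k (k + 1) l (by omega) hkp (Finset.mem_range.1 hl).le)
        (hrev l (Finset.mem_range.1 hl).le)
        (hffg' 0 k l hk (by omega) (Finset.mem_range.1 hl).le)
        (hffg' k (k + 1) (l + 1) (by omega) hkp (Finset.mem_range.1 hl))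
        (hrev (l + 1) (Finset.mem_range.1 hl))
        (hffg' 0 k (l + 1) hk (by omega) (Finset.mem_range.1 hl))
        (hggf' l 0 (Finset.mem_range.1 hl) (by omega))
        (hggf' l k (Finset.mem_range.1 hl) (by omega))
        (hggf' l (k + 1) (Finset.mem_range.1 hl) hkp)]
      -- The sum telescopes to the two ends of `g`, which are the same projective point.
      rw [sum_add_succ_zmod_two (fun l => insideTriangle (f 0) (f k) (f (k + 1)) (g l)), hg,
        insideTriangle_neg (hffg k (k + 1) 0 (by omega) hkp (by omega)) (hrev 0 (by omega))
          (hffg 0 k 0 hk (by omega) (by omega))]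
      exact CharTwo.add_self_eq_zero _
    rw [hcomm 0 (k + 1) (by omega) hkp] at hsum
    exact CharTwo.add_eq_zero.1 hsum
  have hpath : ∀ m, m + 1 < p →
      ∑ k ∈ Finset.range (m + 1), I (f k) (f (k + 1)) = I (f 0) (f (m + 1)) := by
    intro m
    induction m with
    | zero => intro _; simp
    | succ m ih =>
      intro hm
      rw [Finset.sum_range_succ, ih (by omega), htri (m + 1) (by omega) hm]
  obtain ⟨n, rfl⟩ : ∃ n, p = n + 2 := ⟨p - 2, by omega⟩
  change ∑ k ∈ Finset.range (n + 2), I (f k) (f (k + 1)) = 1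
  rw [Finset.sum_range_succ, hpath n (by omega), show n + 1 + 1 = n + 2 from rfl, hf]
  -- Here the sum telescopes to the signs at `g 0` and `-g 0`, which differ: this is the odd
  -- crossing.
  have hneg : I (f (n + 1)) (-f 0) = I (f (n + 1)) (f 0) + 1 := by
    have hrev : ∀ l ≤ q, tripleDet (f (n + 1)) (f 0) (g l) ≠ 0 := by
      intro l hl
      rw [tripleDet_swap_left]
      exact neg_ne_zero.2 (hffg' 0 (n + 1) l (by omega) (by omega) hl)
    simp only [hI]
    rw [Finset.sum_congr rfl fun l hl => crossing_neg_mid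
      (hrev l (Finset.mem_range.1 hl).le) (hrev (l + 1) (Finset.mem_range.1 hl))
      (hggf' l 0 (Finset.mem_range.1 hl) (by omega)), Finset.sum_add_distrib,
      sum_add_succ_zmod_two (fun l => signBit (tripleDet (f (n + 1)) (f 0) (g l))), hg,
      tripleDet_neg_right, signBit_neg (hrev 0 (by omega)), ← add_assoc, ← add_assoc,
      add_assoc _ (signBit _) (signBit _), CharTwo.add_self_eq_zero, add_zero]
  rw [hneg, hcomm 0 (n + 1) (by omega) (by omega), ← add_assoc, CharTwo.add_self_eq_zero, zero_add]

/-- The Plücker relation gives a vector common to both planes. Opposite signs within each pair of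
determinants make its coefficients, up to a global sign on each side, nonnegative. Scaling the
weights to total 1 prepares the compactness argument. -/
lemma cone_inter_of_crossing_ne_zero {a b c d : Fin 3 → ℝ} (h : crossing a b c d ≠ 0) :
    ∃ w ∈ stdSimplex ℝ (Fin 4), ∃ e ∈ ({1, -1} : Finset ℝ),
      w 0 • a + w 1 • b = e • (w 2 • c + w 3 • d) := by
  have key : ∀ {r s : ℝ}, signBit r + signBit s ≠ 0 → (r < 0 ∧ 0 ≤ s) ∨ (0 ≤ r ∧ s < 0) := by
    intro r s hrs
    rcases lt_or_ge r 0 with h1 | h1 <;> rcases lt_or_ge s 0 with h2 | h2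
    · rw [signBit_of_neg h1, signBit_of_neg h2] at hrs; exact absurd rfl hrs
    · exact Or.inl ⟨h1, h2⟩
    · exact Or.inr ⟨h1, h2⟩
    · rw [signBit, signBit, if_neg h1.not_gt, if_neg h2.not_gt] at hrs; exact absurd rfl hrs
  have hP := key (left_ne_zero_of_mul h)
  have hQ := key (right_ne_zero_of_mul h)
  have plucker : tripleDet c d b • a - tripleDet c d a • b =
      tripleDet a b c • d - tripleDet a b d • c := by
    ext i
    fin_cases i <;> simp [tripleDet] <;> ring
  have normalize : ∀ (u₀ u₁ u₂ u₃ e : ℝ), 0 ≤ u₀ → 0 ≤ u₁ → 0 ≤ u₂ → 0 ≤ u₃ →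
      0 < u₀ + u₁ + u₂ + u₃ → e ∈ ({1, -1} : Finset ℝ) →
      u₀ • a + u₁ • b = e • (u₂ • c + u₃ • d) →
      ∃ w ∈ stdSimplex ℝ (Fin 4), ∃ e ∈ ({1, -1} : Finset ℝ),
        w 0 • a + w 1 • b = e • (w 2 • c + w 3 • d) := by
    intro u₀ u₁ u₂ u₃ e h0 h1 h2 h3 hs he heq
    set S := u₀ + u₁ + u₂ + u₃ with hS
    refine ⟨![S⁻¹ * u₀, S⁻¹ * u₁, S⁻¹ * u₂, S⁻¹ * u₃], ⟨?_, ?_⟩, e, he, ?_⟩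
    · intro i
      fin_cases i <;> simp <;> positivity
    · simp only [Fin.sum_univ_four, Matrix.cons_val]
      rw [← mul_add, ← mul_add, ← mul_add, ← hS]
      exact inv_mul_cancel₀ hs.ne'
    · simp only [Matrix.cons_val, mul_smul, ← smul_add]
      rw [heq, smul_comm]
  generalize tripleDet a b c = P at *
  generalize tripleDet a b d = Q at *
  generalize tripleDet c d a = R at *
  generalize tripleDet c d b = S at *
  rcases hP with ⟨h1, h2⟩ | ⟨h1, h2⟩ <;> rcases hQ with ⟨h3, h4⟩ | ⟨h3, h4⟩
  · refine normalize S (-R) Q (-P) (-1) (by linarith) (by linarith) (by linarith) (by linarith)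
      (by linarith) (by simp) ?_
    linear_combination (norm := module) (1 : ℝ) • plucker
  · refine normalize (-S) R Q (-P) 1 (by linarith) (by linarith) (by linarith) (by linarith)
      (by linarith) (by simp) ?_
    linear_combination (norm := module) (-1 : ℝ) • plucker
  · refine normalize S (-R) (-Q) P 1 (by linarith) (by linarith) (by linarith) (by linarith)
      (by linarith) (by simp) ?_
    linear_combination (norm := module) (1 : ℝ) • plucker
  · refine normalize (-S) R (-Q) P (-1) (by linarith) (by linarith) (by linarith) (by linarith)
      (by linarith) (by simp) ?_
    linear_combination (norm := module) (-1 : ℝ) • plucker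

/-! ### Perturbation to general position and passage to the limit -/

/-- Points of the moment curve; any three of them are linearly independent. -/
def momentPoint (i : ℕ) : Fin 3 → ℝ := ![1, i, (i : ℝ) ^ 2]

lemma tripleDet_momentPoint_ne_zero {i j k : ℕ} (hij : i < j) (hjk : j < k) :
    tripleDet (momentPoint i) (momentPoint j) (momentPoint k) ≠ 0 := by
  have h1 : (i : ℝ) < j := by exact_mod_cast hij
  have h2 : (j : ℝ) < k := by exact_mod_cast hjk
  have : tripleDet (momentPoint i) (momentPoint j) (momentPoint k) =
      ((j : ℝ) - i) * (k - i) * (k - j) := by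
    simp [tripleDet, momentPoint]; ring
  rw [this]
  have := sub_pos.2 h1
  have := sub_pos.2 h2
  have := sub_pos.2 (h1.trans h2)
  positivity

/-- The determinant is a cubic polynomial in `t` with nonzero leading coefficient, so it has
finitely many roots. -/
lemma eventually_tripleDet_perturb_ne_zero {a b c a' b' c' : Fin 3 → ℝ}
    (h : tripleDet a' b' c' ≠ 0) :
    ∀ᶠ t in 𝓝[≠] (0 : ℝ), tripleDet (a + t • a') (b + t • b') (c + t • c') ≠ 0 := by
  let P : Polynomial ℝ := (Cubic.mk (tripleDet a' b' c')
    (tripleDet a b' c' + tripleDet a' b c' + tripleDet a' b' c)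
    (tripleDet a b c' + tripleDet a b' c + tripleDet a' b c) (tripleDet a b c)).toPoly
  have hP : P ≠ 0 := Cubic.ne_zero_of_a_ne_zero h
  have hfin : {t | P.IsRoot t}.Finite := Polynomial.finite_setOfPred_isRoot hP
  have hev : ∀ t, P.eval t = tripleDet (a + t • a') (b + t • b') (c + t • c') := by
    intro t
    simp [P, Cubic.toPoly, tripleDet]; ring
  have h2 : ({t | P.IsRoot t} \ {0})ᶜ ∈ 𝓝 (0 : ℝ) :=
    (hfin.subset Set.sdiff_subset).isClosed.isOpen_compl.mem_nhds (by simp)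
  rw [eventually_nhdsWithin_iff]
  filter_upwards [h2] with t ht ht0
  rw [← hev t]
  exact fun h0 => ht ⟨h0, ht0⟩

lemma eventually_generic (h : ℕ → Fin 3 → ℝ) (n : ℕ) :
    ∀ᶠ t in 𝓝[≠] (0 : ℝ), ∀ i < n, ∀ j < n, ∀ k < n, i < j → j < k →
      tripleDet (h i + t • momentPoint i) (h j + t • momentPoint j)
        (h k + t • momentPoint k) ≠ 0 := by
  refine (Set.finite_lt_nat n).eventually_all.2 fun i _ =>
    (Set.finite_lt_nat n).eventually_all.2 fun j _ =>
    (Set.finite_lt_nat n).eventually_all.2 fun k _ => ?_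
  by_cases hij : i < j
  · by_cases hjk : j < k
    · filter_upwards [eventually_tripleDet_perturb_ne_zero
        (tripleDet_momentPoint_ne_zero hij hjk)] with t ht _ _ using ht
    · exact Eventually.of_forall fun t _ h => absurd h hjk
  · exact Eventually.of_forall fun t h => absurd h hij

/-- Two antipodal polygons meet in the projective plane. -/
theorem exists_cone_inter {p q : ℕ} (hp : 2 ≤ p) (hq : 2 ≤ q) (f g : ℕ → Fin 3 → ℝ)
    (hf : f p = -f 0) (hg : g q = -g 0) :
    ∃ k < p, ∃ l < q, ∃ w ∈ stdSimplex ℝ (Fin 4), ∃ e ∈ ({1, -1} : Finset ℝ),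
      w 0 • f k + w 1 • f (k + 1) = e • (w 2 • g l + w 3 • g (l + 1)) := by
  -- The last perturbation is the negative of the first, so antipodality survives; `W` uses moment
  -- points from `p` on, distinct from those of `V`.
  let V : ℕ → Fin 3 → ℝ := fun i => if i < p then momentPoint i else -momentPoint 0
  let W : ℕ → Fin 3 → ℝ := fun i => if i < q then momentPoint (p + i) else -momentPoint p
  let F : ℝ → ℕ → Fin 3 → ℝ := fun t i => f i + t • V i
  let G : ℝ → ℕ → Fin 3 → ℝ := fun t i => g i + t • W i
  let S : Set ℝ := {t | ∃ k < p, ∃ l < q, ∃ e ∈ ({1, -1} : Finset ℝ),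
    ∃ w ∈ stdSimplex ℝ (Fin 4),
      w 0 • F t k + w 1 • F t (k + 1) = e • (w 2 • G t l + w 3 • G t (l + 1))}
  -- For fixed `k`, `l`, `e` the admissible times are the projection of a closed set along the
  -- compact simplex.
  have hclosed : IsClosed S := by
    have : S = ⋃ k ∈ {k | k < p}, ⋃ l ∈ {l | l < q}, ⋃ e ∈ ({1, -1} : Finset ℝ),
        Prod.fst '' {z : ℝ × stdSimplex ℝ (Fin 4) |
          z.2.1 0 • F z.1 k + z.2.1 1 • F z.1 (k + 1) =
            e • (z.2.1 2 • G z.1 l + z.2.1 3 • G z.1 (l + 1))} := by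
      ext t
      simp [S]
    rw [this]
    refine (Set.finite_lt_nat p).isClosed_biUnion fun k _ =>
      (Set.finite_lt_nat q).isClosed_biUnion fun l _ =>
      (Finset.finite_toSet _).isClosed_biUnion fun e _ => ?_
    have hw : ∀ i, Continuous fun z : ℝ × stdSimplex ℝ (Fin 4) => z.2.1 i := fun i =>
      (continuous_apply i).comp (continuous_subtype_val.comp continuous_snd)
    have hF : ∀ i, Continuous fun z : ℝ × stdSimplex ℝ (Fin 4) => F z.1 i := fun i =>
      continuous_const.add (continuous_fst.smul continuous_const)
    have hG : ∀ i, Continuous fun z : ℝ × stdSimplex ℝ (Fin 4) => G z.1 i := fun i =>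
      continuous_const.add (continuous_fst.smul continuous_const)
    exact isClosedMap_fst_of_compactSpace _ (isClosed_eq
      (((hw 0).smul (hF k)).add ((hw 1).smul (hF (k + 1))))
      ((((hw 2).smul (hG l)).add ((hw 3).smul (hG (l + 1)))).const_smul e))
  have hev : ∀ᶠ t in 𝓝[≠] (0 : ℝ), t ∈ S := by
    filter_upwards [eventually_generic (fun i => if i < p then f i else g (i - p)) (p + q)]
      with t ht
    have hFv : ∀ i < p, F t i = (if i < p then f i else g (i - p)) + t • momentPoint i := by
      intro i hi
      simp [F, V, hi]
    have hGv : ∀ l < q, G t l = (if p + l < p then f (p + l) else g (p + l - p)) +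
        t • momentPoint (p + l) := by
      intro l hl
      simp [G, W, hl]
    have hsum := sum_crossing_eq_one hp hq (F t) (G t)
      (by simp [F, V, hf, show 0 < p by omega]; abel) (by simp [G, W, hg, show 0 < q by omega]; abel)
      (fun i j k hij hjk hk => by
        rw [hFv i (by omega), hFv j (by omega), hFv k hk]
        exact ht i (by omega) j (by omega) k (by omega) hij hjk)
      (fun i j l hij hj hl => by
        rw [hFv i (by omega), hFv j (by omega), hGv l hl]
        exact ht i (by omega) j (by omega) (p + l) (by omega) hij (by omega))
      (fun l m i hlm hm hi => by
        rw [hFv i hi, hGv m hm, hGv l (by omega), tripleDet_rotate]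
        exact ht i (by omega) (p + l) (by omega) (p + m) (by omega) (by omega) (by omega))
    obtain ⟨k, hk, hk0⟩ := Finset.exists_ne_zero_of_sum_ne_zero (hsum.trans_ne one_ne_zero)
    obtain ⟨l, hl, hl0⟩ := Finset.exists_ne_zero_of_sum_ne_zero hk0
    obtain ⟨w, hw, e, he, heq⟩ := cone_inter_of_crossing_ne_zero hl0
    exact ⟨k, Finset.mem_range.1 hk, l, Finset.mem_range.1 hl, e, he, w, hw, heq⟩
  have h0 : (0 : ℝ) ∈ S := hclosed.closure_subset
    (mem_closure_iff_frequently.2 (hev.frequently.filter_mono nhdsWithin_le_nhds))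
  obtain ⟨k, hk, l, hl, e, he, w, hw, heq⟩ := h0
  refine ⟨k, hk, l, hl, w, hw, e, he, ?_⟩
  simpa [F, G] using heq

/-! ### Signed edges and the directions of a chain -/

section Chain

variable {E : Type*} [AddCommGroup E] [Module ℝ E] {p : ℕ} {x : ZMod p → E}

/-- The needle of the Kakeya motion along a chain at the time `k`: an edge of the chain, with
alternating orientation. -/
def needleVertex (x : ZMod p → E) (k : ℕ) : E := (-1 : ℝ) ^ k • (x (k + 2) - x (k + 1))

lemma needleVertex_add_period (hp : Odd p) (x : ZMod p → E) (k : ℕ) :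
    needleVertex x (k + p) = -needleVertex x k := by
  simp [needleVertex, pow_add, hp.neg_one_pow]

lemma lineMap_needleVertex_of_even (x : ZMod p → E) {k : ℕ} (hk : Even k) (s : ℝ) :
    AffineMap.lineMap (needleVertex x k) (needleVertex x (k + 1)) s =
      x (k + 2) - AffineMap.lineMap (x (k + 1)) (x (k + 3)) s := by
  have h2 : (k : ZMod p) + 1 + 2 = k + 3 := by ring
  have h3 : (k : ZMod p) + 1 + 1 = k + 2 := by ring
  simp only [needleVertex, pow_succ, hk.neg_one_pow, AffineMap.lineMap_apply_module]
  push_cast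
  rw [h2, h3]
  module

lemma lineMap_needleVertex_of_odd (x : ZMod p → E) {k : ℕ} (hk : Odd k) (s : ℝ) :
    AffineMap.lineMap (needleVertex x k) (needleVertex x (k + 1)) s =
      AffineMap.lineMap (x (k + 1)) (x (k + 3)) s - x (k + 2) := by
  have h2 : (k : ZMod p) + 1 + 2 = k + 3 := by ring
  have h3 : (k : ZMod p) + 1 + 1 = k + 2 := by ring
  simp only [needleVertex, pow_succ, hk.neg_one_pow, AffineMap.lineMap_apply_module]
  push_cast
  rw [h2, h3]
  module

lemma lineMap_needleVertex_ne_zero (hx : ChainNondegenerate x) (k : ℕ) {s : ℝ}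
    (hs : s ∈ Set.Icc (0 : ℝ) 1) :
    AffineMap.lineMap (needleVertex x k) (needleVertex x (k + 1)) s ≠ 0 := by
  intro h
  apply hx (k + 2)
  rw [show (k : ZMod p) + 2 - 1 = k + 1 by ring, show (k : ZMod p) + 2 + 1 = k + 3 by ring,
    segment_eq_image_lineMap]
  refine ⟨s, hs, ?_⟩
  rcases k.even_or_odd with hk | hk
  · rw [lineMap_needleVertex_of_even x hk, sub_eq_zero] at h
    exact h.symm
  · rwa [lineMap_needleVertex_of_odd x hk, sub_eq_zero] at h

lemma ray_lineMap_needleVertex_mem (x : ZMod p → E) (k : ℕ) {s : ℝ}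
    (hs : s ∈ Set.Icc (0 : ℝ) 1)
    (h : AffineMap.lineMap (needleVertex x k) (needleVertex x (k + 1)) s ≠ 0) :
    rayOfNeZero ℝ _ h ∈ chainDirections x := by
  refine Set.mem_iUnion.2 ⟨(k : ZMod p) + 2, ?_⟩
  rw [show (k : ZMod p) + 2 - 1 = k + 1 by ring, show (k : ZMod p) + 2 + 1 = k + 3 by ring]
  have hz : AffineMap.lineMap (x (k + 1)) (x (k + 3)) s ∈ segment ℝ (x (k + 1)) (x (k + 3)) := by
    rw [segment_eq_image_lineMap]
    exact ⟨s, hs, rfl⟩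
  rcases k.even_or_odd with hk | hk
  · right
    have he := lineMap_needleVertex_of_even x hk s
    exact ⟨_, hz, he ▸ h, by simp only [he]⟩
  · left
    have he := lineMap_needleVertex_of_odd x hk s
    exact ⟨_, hz, he ▸ h, by simp only [he]⟩

/-- For an odd chain, each position of the chain is visited at times of either parity. -/
lemma exists_parity_cast_add_two_eq (hp : Odd p) (i : ZMod p) (m : ℕ) :
    ∃ k < 2 * p, k % 2 = m % 2 ∧ (k : ZMod p) + 2 = i := by
  have : NeZero p := ⟨hp.pos.ne'⟩
  have hlt := ZMod.val_lt (i - 2)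
  have hval : ((i - 2).val : ZMod p) = i - 2 := ZMod.natCast_zmod_val _
  obtain ⟨r, hr⟩ := hp
  by_cases h : (i - 2).val % 2 = m % 2
  · exact ⟨(i - 2).val, by omega, h, by rw [hval]; ring⟩
  · exact ⟨(i - 2).val + p, by omega, by omega, by push_cast; rw [hval, ZMod.natCast_self]; ring⟩

lemma exists_lineMap_needleVertex_of_mem (hp : Odd p) {d : Module.Ray ℝ E}
    (hd : d ∈ chainDirections x) :
    ∃ k < 2 * p, ∃ s ∈ Set.Icc (0 : ℝ) 1,
      ∃ h : AffineMap.lineMap (needleVertex x k) (needleVertex x (k + 1)) s ≠ 0,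
        d = rayOfNeZero ℝ _ h := by
  obtain ⟨i, hi⟩ := Set.mem_iUnion.1 hd
  rcases hi with ⟨z, hz, h, rfl⟩ | ⟨z, hz, h, rfl⟩
  · obtain ⟨k, hk, hk2, rfl⟩ := exists_parity_cast_add_two_eq hp i 1
    rw [show (k : ZMod p) + 2 - 1 = k + 1 by ring, show (k : ZMod p) + 2 + 1 = k + 3 by ring,
      segment_eq_image_lineMap] at hz
    obtain ⟨s, hs, rfl⟩ := hz
    have he := lineMap_needleVertex_of_odd x (Nat.odd_iff.2 hk2) s
    exact ⟨k, hk, s, hs, he ▸ h, by simp only [he]⟩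
  · obtain ⟨k, hk, hk2, rfl⟩ := exists_parity_cast_add_two_eq hp i 0
    rw [show (k : ZMod p) + 2 - 1 = k + 1 by ring, show (k : ZMod p) + 2 + 1 = k + 3 by ring,
      segment_eq_image_lineMap] at hz
    obtain ⟨s, hs, rfl⟩ := hz
    have he := lineMap_needleVertex_of_even x (Nat.even_iff.2 hk2) s
    exact ⟨k, hk, s, hs, he ▸ h, by simp only [he]⟩

lemma ray_neg_mem_chainDirections {u : E} {h : u ≠ 0} (h' : -u ≠ 0)
    (hu : rayOfNeZero ℝ u h ∈ chainDirections x) :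
    rayOfNeZero ℝ (-u) h' ∈ chainDirections x := by
  rw [← neg_rayOfNeZero ℝ u h]
  obtain ⟨i, hi⟩ := Set.mem_iUnion.1 hu
  refine Set.mem_iUnion.2 ⟨i, ?_⟩
  rcases hi with ⟨z, hz, h0, he⟩ | ⟨z, hz, h0, he⟩
  · refine Or.inr ⟨z, hz, neg_sub z (x i) ▸ neg_ne_zero.2 h0, ?_⟩
    rw [he, neg_rayOfNeZero]
    simp only [neg_sub]
  · refine Or.inl ⟨z, hz, neg_sub (x i) z ▸ neg_ne_zero.2 h0, ?_⟩
    rw [he, neg_rayOfNeZero]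
    simp only [neg_sub]

lemma cone_eq_smul_lineMap (u v : E) {a b : ℝ} (hab : 0 < a + b) :
    a • u + b • v = (a + b) • AffineMap.lineMap u v (b / (a + b)) := by
  rw [AffineMap.lineMap_apply_module, smul_add, smul_smul, smul_smul, mul_sub, mul_one,
    mul_div_cancel₀ _ hab.ne', add_sub_cancel_right]

lemma cone_needleVertex_ne_zero (hx : ChainNondegenerate x) (k : ℕ) {a b : ℝ} (ha : 0 ≤ a)
    (hb : 0 ≤ b) (hab : 0 < a + b) : a • needleVertex x k + b • needleVertex x (k + 1) ≠ 0 := by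
  rw [cone_eq_smul_lineMap _ _ hab]
  exact smul_ne_zero hab.ne' (lineMap_needleVertex_ne_zero hx k
    ⟨by positivity, div_le_one_of_le₀ (by linarith) hab.le⟩)

lemma ray_cone_needleVertex_mem (k : ℕ) {a b : ℝ} (ha : 0 ≤ a) (hb : 0 ≤ b)
    (h : a • needleVertex x k + b • needleVertex x (k + 1) ≠ 0) :
    rayOfNeZero ℝ _ h ∈ chainDirections x := by
  have hab : 0 < a + b := by
    refine (add_nonneg ha hb).lt_of_ne' fun h0 => h ?_
    rw [show a = 0 by linarith, show b = 0 by linarith]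
    simp
  have h' := h
  rw [cone_eq_smul_lineMap _ _ hab] at h'
  have h0 := right_ne_zero_of_smul h'
  have hmem := ray_lineMap_needleVertex_mem x k (s := b / (a + b))
    ⟨by positivity, div_le_one_of_le₀ (by linarith) hab.le⟩ h0
  convert hmem using 1
  rw [ray_eq_iff, cone_eq_smul_lineMap _ _ hab]
  exact SameRay.sameRay_pos_smul_left _ hab

end Chain

/-! ### Construction of the motion and its direction curve -/

section Motion

variable {E : Type*} [NormedAddCommGroup E] [NormedSpace ℝ E] {p : ℕ} {x : ZMod p → E}

/-- The path that runs through the points `A 0, …, A n` at integer times, and along segments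
in between. -/
noncomputable def polygonalPath (A : ℕ → E) (n : ℕ) (t : ℝ) : E :=
  A 0 + ∑ k ∈ Finset.range n, max 0 (min 1 (t - k)) • (A (k + 1) - A k)

lemma continuous_polygonalPath (A : ℕ → E) (n : ℕ) : Continuous (polygonalPath A n) := by
  unfold polygonalPath
  fun_prop

/-- At time `k + s` the clamped weights are 1 before index `k`, `s` at `k` and 0 after it, so the
sum telescopes. -/
lemma polygonalPath_add (A : ℕ → E) {n k : ℕ} (hk : k < n) {s : ℝ} (hs : s ∈ Set.Icc (0 : ℝ) 1) :
    polygonalPath A n (k + s) = AffineMap.lineMap (A k) (A (k + 1)) s := by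
  obtain ⟨hs0, hs1⟩ := hs
  rw [polygonalPath, ← Finset.sum_subset (Finset.range_mono (Nat.succ_le_of_lt hk)),
    Finset.sum_range_succ, Finset.sum_congr rfl (g := fun j => A (j + 1) - A j),
    Finset.sum_range_sub, add_sub_cancel_left, min_eq_right hs1, max_eq_right hs0,
    AffineMap.lineMap_apply_module']
  · abel
  · intro j hj
    have : (j : ℝ) + 1 ≤ k := by exact_mod_cast Finset.mem_range.1 hj
    rw [min_eq_left (by linarith), max_eq_right zero_le_one, one_smul]
  · intro j _ hj
    have : (k : ℝ) + 1 ≤ j := by exact_mod_cast not_lt.1 (mt Finset.mem_range.2 hj)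
    rw [max_eq_left (min_le_of_right_le (by linarith)), zero_smul]

lemma exists_nat_add_eq {n : ℕ} (hn : 0 < n) {t : ℝ} (ht : t ∈ Set.Icc (0 : ℝ) n) :
    ∃ k < n, ∃ s ∈ Set.Icc (0 : ℝ) 1, t = k + s := by
  rcases ht.2.lt_or_eq with h | rfl
  · exact ⟨⌊t⌋₊, (Nat.floor_lt ht.1).2 h, t - ⌊t⌋₊, ⟨sub_nonneg.2 (Nat.floor_le ht.1),
      by linarith [Nat.lt_floor_add_one t]⟩, by ring⟩
  · exact ⟨n - 1, by omega, 1, by simp, by rw [Nat.cast_pred hn]; ring⟩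

lemma exists_isKakeyaMotion (x : ZMod p → E) : ∃ a b : ℝ → E, IsKakeyaMotion x a b := by
  refine ⟨polygonalPath (fun k => if Even k then x (k + 1) else x (k + 2)) (2 * p),
    polygonalPath (fun k => if Even k then x (k + 2) else x (k + 1)) (2 * p),
    (continuous_polygonalPath _ _).continuousOn, (continuous_polygonalPath _ _).continuousOn,
    fun k hk s hs => ?_⟩
  have h2 : (k : ZMod p) + 1 + 2 = k + 3 := by ring
  have h3 : (k : ZMod p) + 1 + 1 = k + 2 := by ring
  rw [polygonalPath_add _ hk hs, polygonalPath_add _ hk hs]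
  refine ⟨fun he => ?_, fun ho => ?_⟩
  · simp [he, h2, h3, Nat.even_add_one]
  · have he := Nat.not_even_iff_odd.2 ho
    simp [he, h2, h3, Nat.even_add_one]

lemma IsKakeyaMotion.sub_eq {a b : ℝ → E} (h : IsKakeyaMotion x a b) {k : ℕ} (hk : k < 2 * p)
    {s : ℝ} (hs : s ∈ Set.Icc (0 : ℝ) 1) :
    b (k + s) - a (k + s) =
      AffineMap.lineMap (needleVertex x k) (needleVertex x (k + 1)) s := by
  rcases k.even_or_odd with he | ho
  · rw [lineMap_needleVertex_of_even x he, ((h.2.2 k hk s hs).1 he).1,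
      ((h.2.2 k hk s hs).1 he).2]
  · rw [lineMap_needleVertex_of_odd x ho, ((h.2.2 k hk s hs).2 ho).1,
      ((h.2.2 k hk s hs).2 ho).2]

theorem sweptByKakeyaMotion (hp : Odd p) (hx : ChainNondegenerate x) : SweptByKakeyaMotion x := by
  obtain ⟨a, b, hab⟩ := exists_isKakeyaMotion x
  have hpos : 0 < 2 * p := by have := hp.pos; omega
  have htime : ∀ t ∈ Set.Icc (0 : ℝ) (2 * p), ∃ k < 2 * p, ∃ s ∈ Set.Icc (0 : ℝ) 1,
      t = k + s := by
    intro t ht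
    exact exists_nat_add_eq hpos (by push_cast; exact ht)
  have hmem : ∀ k < 2 * p, ∀ s ∈ Set.Icc (0 : ℝ) 1, (k + s : ℝ) ∈ Set.Icc (0 : ℝ) (2 * p) := by
    intro k hk s hs
    have : (k : ℝ) + 1 ≤ 2 * p := by exact_mod_cast hk
    exact ⟨add_nonneg k.cast_nonneg hs.1, by linarith [hs.2]⟩
  have hne : ∀ t ∈ Set.Icc (0 : ℝ) (2 * p), b t - a t ≠ 0 := by
    intro t ht
    obtain ⟨k, hk, s, hs, rfl⟩ := htime t ht
    rw [hab.sub_eq hk hs]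
    exact lineMap_needleVertex_ne_zero hx k hs
  have hdir : chainDirections x = {d | ∃ t ∈ Set.Icc (0 : ℝ) (2 * p),
      ∃ h : b t - a t ≠ 0, d = rayOfNeZero ℝ (b t - a t) h} := by
    ext d
    constructor
    · intro hd
      obtain ⟨k, hk, s, hs, h, rfl⟩ := exists_lineMap_needleVertex_of_mem hp hd
      have he := hab.sub_eq hk hs
      exact ⟨k + s, hmem k hk s hs, he ▸ h, by simp only [he]⟩
    · rintro ⟨t, ht, h, rfl⟩
      obtain ⟨k, hk, s, hs, rfl⟩ := htime t ht
      have he := hab.sub_eq hk hs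
      simp only [he]
      exact ray_lineMap_needleVertex_mem x k hs _
  have himage : (fun t => ‖b t - a t‖⁻¹ • (b t - a t)) '' Set.Icc (0 : ℝ) (2 * p) =
      spherePoints (chainDirections x) := by
    ext u
    constructor
    · rintro ⟨t, ht, rfl⟩
      have h := hne t ht
      have hn := inv_pos.2 (norm_pos_iff.2 h)
      refine ⟨norm_smul_inv_norm h, smul_ne_zero hn.ne' h, ?_⟩
      rw [hdir]
      refine ⟨t, ht, h, ?_⟩
      rw [ray_eq_iff]
      exact SameRay.sameRay_pos_smul_left _ hn
    · rintro ⟨hu, hu0, hd⟩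
      rw [hdir] at hd
      obtain ⟨t, ht, h, he⟩ := hd
      refine ⟨t, ht, ?_⟩
      have := (sameRay_iff_inv_norm_smul_eq_of_ne hu0 h).1 ((ray_eq_iff hu0 h).1 he)
      simpa [hu] using this.symm
  refine ⟨a, b, hab, hne, hdir, ⟨?_, ?_, ?_, ?_⟩, himage⟩
  · have hc : ContinuousOn (fun t => b t - a t) (Set.Icc 0 (2 * p)) := hab.2.1.sub hab.1
    exact (hc.norm.inv₀ fun t ht => norm_ne_zero_iff.2 (hne t ht)).smul hc
  · intro t ht
    exact norm_smul_inv_norm (hne t ht)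
  · have h0 : b 0 - a 0 = needleVertex x 0 := by
      simpa using hab.sub_eq hpos (s := 0) (by simp)
    have h1 : b (2 * p) - a (2 * p) = needleVertex x (2 * p) := by
      have := hab.sub_eq (k := 2 * p - 1) (by omega) (s := 1) (by simp)
      rwa [Nat.cast_pred hpos, sub_add_cancel, Nat.sub_add_cancel hpos,
        AffineMap.lineMap_apply_one, Nat.cast_mul, Nat.cast_ofNat] at this
    have h2 : needleVertex x (2 * p) = needleVertex x 0 := by
      have e1 := needleVertex_add_period hp x 0
      have e2 := needleVertex_add_period hp x (0 + p)
      rw [e1, neg_neg, zero_add, ← two_mul] at e2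
      exact e2
    simp only [h0, h1, h2]
  · rw [himage]
    rintro u ⟨hu, h0, hd⟩
    exact ⟨by rwa [norm_neg], neg_ne_zero.2 h0, ray_neg_mem_chainDirections _ hd⟩

end Motion

/-! ### Common directions of two chains -/

lemma ChainNondegenerate.two_le {E : Type*} [AddCommGroup E] [Module ℝ E] {p : ℕ}
    {x : ZMod p → E} (hp : Odd p) (hx : ChainNondegenerate x) : 2 ≤ p := by
  by_contra h
  obtain rfl : p = 1 := by have := hp.pos; omega
  apply hx 0
  rw [Subsingleton.elim (0 - 1 : ZMod 1) 0]
  exact left_mem_segment ℝ _ _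

theorem chainDirections_inter_nonempty {p q : ℕ} (hp : Odd p) (hq : Odd q)
    {x : ZMod p → EuclideanSpace ℝ (Fin 3)} {y : ZMod q → EuclideanSpace ℝ (Fin 3)}
    (hx : ChainNondegenerate x) (hy : ChainNondegenerate y) :
    (chainDirections x ∩ chainDirections y).Nonempty := by
  obtain ⟨k, -, l, -, w, ⟨hw, hsum⟩, e, he, heq⟩ := exists_cone_inter (hx.two_le hp)
    (hy.two_le hq) (fun i => (needleVertex x i).ofLp) (fun i => (needleVertex y i).ofLp)
    (by have := needleVertex_add_period hp x 0; rw [zero_add] at this; simp [this])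
    (by have := needleVertex_add_period hq y 0; rw [zero_add] at this; simp [this])
  replace heq : w 0 • needleVertex x k + w 1 • needleVertex x (k + 1) =
      e • (w 2 • needleVertex y l + w 3 • needleVertex y (l + 1)) := WithLp.ofLp_injective 2 heq
  have he0 : e ≠ 0 := by
    rintro rfl
    norm_num at he
  rw [Fin.sum_univ_four] at hsum
  -- The weights may vanish on one side but not on both, since they sum to 1; the side with positive
  -- total shows that the common vector is nonzero.
  have hv : w 0 • needleVertex x k + w 1 • needleVertex x (k + 1) ≠ 0 := by
    rcases (add_nonneg (hw 0) (hw 1)).lt_or_eq with h | h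
    · exact cone_needleVertex_ne_zero hx k (hw 0) (hw 1) h
    · rw [heq]
      exact smul_ne_zero he0 (cone_needleVertex_ne_zero hy l (hw 2) (hw 3) (by linarith))
  have hv' : w 2 • needleVertex y l + w 3 • needleVertex y (l + 1) ≠ 0 := by
    rw [heq] at hv
    exact right_ne_zero_of_smul hv
  refine ⟨rayOfNeZero ℝ _ hv, ray_cone_needleVertex_mem k (hw 0) (hw 1) hv, ?_⟩
  have hmem := ray_cone_needleVertex_mem l (hw 2) (hw 3) hv'
  simp only [Finset.mem_insert, Finset.mem_singleton] at he
  rcases he with rfl | rfl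
  · simpa only [heq, one_smul] using hmem
  · simpa only [heq, neg_smul, one_smul] using
      ray_neg_mem_chainDirections (neg_ne_zero.2 hv') hmem

theorem mainTheorem3 (p q : ℕ) (hp : Odd p) (hq : Odd q)
    (x : ZMod p → EuclideanSpace ℝ (Fin 3)) (y : ZMod q → EuclideanSpace ℝ (Fin 3))
    (hx : ChainNondegenerate x) (hy : ChainNondegenerate y) :
    (chainDirections x ∩ chainDirections y).Nonempty ∧
      SweptByKakeyaMotion x ∧ SweptByKakeyaMotion y :=
  ⟨chainDirections_inter_nonempty hp hq hx hy, sweptByKakeyaMotion hp hx,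
    sweptByKakeyaMotion hq hy⟩
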